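/- Let $(M,\rho)$ be a metric space and let $J$, $I$ be relations on $M$ and $d: M\times M\to[0,\infty]$ a function such that $(M,\rho,I,J,d)$ is a Lorentzian pre-length space in the sense of Kunzinger and Sämann: $J$ (written $\le$) is reflexive and transitive; $I$ (written $\ll$) is transitive and contained in $J$; $d$ is lower semicontinuous; $d(x,z)\ge d(x,y)+d(y,z)$ whenever $x\le y\le z$; $d(x,y)=0$ if $x\not\le y$; and $d(x,y)>0$ if and only if $x\ll y$. Write $J^+(K)=\{y: x\le y \text{ for some } x\in K\}$, $J^-(K)=\{x: x\le y\text{ for some } y\in K\}$, $J^\pm(p)=J^\pm(\{p\})$. A causal (timelike) curve is a non-constant, locally $\rho$-Lipschitz map $\gamma$ from an interval of $\mathbb{R}$ to $M$ such that $\gamma(s)\le\gamma(t)$ (respectively $\gamma(s)\ll\gamma(t)$) for all parameters $s<t$. Assume that 1. $M$ is causally path connected: if $x\ll y$ there is a timelike curve defined on a compact interval from $x$ to $y$, and if $x\le y$ and $x\neq y$ there is a causal curve defined on a compact interval from $x$ to $y$; 2. $M$ is $\rho$-compatible: every point has a neighborhood $U$ and a constant $C<\infty$ such that all causal curves contained in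 $U$ have $\rho$-length at most $C$; 3. through each point of $M$ passes a timelike curve, i.e. each point is the value of some timelike curve at an interior point of its parameter interval. Let $(\beta)$ be the property: for every compact set $K\subset M$ there is a constant $C<\infty$ such that all causal curves with image in $K$ have $\rho$-length at most $C$. Then the following properties are equivalent: - (a) $(\beta)$ holds, and $J^+(p)\cap J^-(q)$ is compact for all $p,q\in M$; - (b) $(\beta)$ holds, and $J^+(K_1)\cap J^-(K_2)$ is compact for all compact $K_1,K_2\subset M$; - ($\star$) $J$ is antisymmetric and is a closed subset of $M\times M$, and $J^+(K)\cap J^-(K)$ is compact for every compact $K\subset M$; - (causality and compact diamonds) $J$ is antisymmetric, and $J^+(p)\cap J^-(q)$ is compact for all $p,q\in M$. -/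

import Mathlib

open scoped ENNReal NNReal Topology

/-- A Lorentzian pre-length space in the sense of Kunzinger and Sämann, over the metric space `X`
(whose distance is `ρ`): a preorder `caus` (the relation `J`), a transitive relation `chron`
(the relation `I`) contained in it, and a lower semicontinuous time separation `dist`
with values in `[0, ∞]`. -/
structure LorentzianPreLengthSpace (X : Type*) [MetricSpace X] where
  /-- the causal relation: `caus x y` is `(x, y) ∈ J`, i.e. `x ≤ y` -/
  caus : X → X → Prop
  /-- the chronological relation: `chron x y` is `(x, y) ∈ I`, i.e. `x ≪ y` -/
  chron : X → X → Prop
  /-- the Lorentzian distance (time separation) -/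
  dist : X → X → ℝ≥0∞
  caus_refl : ∀ x, caus x x
  caus_trans : ∀ x y z, caus x y → caus y z → caus x z
  chron_trans : ∀ x y z, chron x y → chron y z → chron x z
  caus_of_chron : ∀ x y, chron x y → caus x y
  dist_lsc : LowerSemicontinuous fun p : X × X => dist p.1 p.2
  reverse_triangle : ∀ x y z, caus x y → caus y z → dist x y + dist y z ≤ dist x z
  dist_eq_zero : ∀ x y, ¬ caus x y → dist x y = 0
  dist_pos_iff : ∀ x y, 0 < dist x y ↔ chron x y

namespace LorentzianPreLengthSpace

variable {X : Type*} [MetricSpace X] (L : LorentzianPreLengthSpace X)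

/-- `J⁺(K)`, the points causally above some point of `K`. -/
def causalFuture (K : Set X) : Set X := {y | ∃ x ∈ K, L.caus x y}

/-- `J⁻(K)`, the points causally below some point of `K`. -/
def causalPast (K : Set X) : Set X := {x | ∃ y ∈ K, L.caus x y}

/-- `γ`, restricted to the interval `S ⊆ ℝ`, is a (future-directed) causal curve: non-constant,
locally Lipschitz for `ρ`, with `γ s ≤ γ t` for all `s < t` in `S`. (Past-directed curves are the
same curves with the parameter reversed; they have the same image and the same length.) -/
structure IsCausalCurve (γ : ℝ → X) (S : Set ℝ) : Prop where
  interval : S.OrdConnected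
  nonconstant : ∃ s ∈ S, ∃ t ∈ S, γ s ≠ γ t
  locallyLipschitz : LocallyLipschitzOn S γ
  causal : ∀ s ∈ S, ∀ t ∈ S, s < t → L.caus (γ s) (γ t)

/-- `γ`, restricted to the interval `S ⊆ ℝ`, is a (future-directed) timelike curve: non-constant,
locally Lipschitz for `ρ`, with `γ s ≪ γ t` for all `s < t` in `S`. -/
structure IsTimelikeCurve (γ : ℝ → X) (S : Set ℝ) : Prop where
  interval : S.OrdConnected
  nonconstant : ∃ s ∈ S, ∃ t ∈ S, γ s ≠ γ t
  locallyLipschitz : LocallyLipschitzOn S γ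
  timelike : ∀ s ∈ S, ∀ t ∈ S, s < t → L.chron (γ s) (γ t)

/-- Points with `x ≪ y` are joined by a timelike curve, and distinct points with `x ≤ y` are
joined by a causal curve. -/
def CausallyPathConnected : Prop :=
  (∀ x y, L.chron x y → ∃ (a b : ℝ) (γ : ℝ → X), a ≤ b ∧
    L.IsTimelikeCurve γ (Set.Icc a b) ∧ γ a = x ∧ γ b = y) ∧
  (∀ x y, L.caus x y → x ≠ y → ∃ (a b : ℝ) (γ : ℝ → X), a ≤ b ∧
    L.IsCausalCurve γ (Set.Icc a b) ∧ γ a = x ∧ γ b = y)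

/-- The `ρ`-lengths of the causal curves contained in the set `A` have a common finite bound.
The `ρ`-length of a curve is its total variation. -/
def BoundedCausalLengthIn (A : Set X) : Prop :=
  ∃ C : ℝ≥0, ∀ (γ : ℝ → X) (S : Set ℝ), L.IsCausalCurve γ S → Set.MapsTo γ S A →
    eVariationOn γ S ≤ C

/-- `ρ`-compatibility: every point has a neighborhood in which causal curves have bounded
`ρ`-length. -/
def RhoCompatible : Prop := ∀ x : X, ∃ U ∈ 𝓝 x, L.BoundedCausalLengthIn U

/-- Through each point passes a timelike curve: the point is attained at an interior parameter. -/
def TimelikeCurveThroughEachPoint : Prop :=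
  ∀ x : X, ∃ (γ : ℝ → X) (S : Set ℝ), L.IsTimelikeCurve γ S ∧ ∃ t ∈ interior S, γ t = x

/-- Causality: `J` is antisymmetric. -/
def Causality : Prop := ∀ x y, L.caus x y → L.caus y x → x = y

/-- Property (β): the causal curves with image in a compact set have bounded `ρ`-length. -/
def NonTotallyImprisoning : Prop := ∀ K : Set X, IsCompact K → L.BoundedCausalLengthIn K

/-- All causal diamonds `J⁺(p) ∩ J⁻(q)` are compact. -/
def CompactDiamonds : Prop :=
  ∀ p q : X, IsCompact (L.causalFuture {p} ∩ L.causalPast {q})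

/-- All causal emeralds `J⁺(K₁) ∩ J⁻(K₂)`, with `K₁`, `K₂` compact, are compact. -/
def CompactEmeralds : Prop :=
  ∀ K₁ K₂ : Set X, IsCompact K₁ → IsCompact K₂ →
    IsCompact (L.causalFuture K₁ ∩ L.causalPast K₂)

/-- Property (a). -/
def PropertyA : Prop := L.NonTotallyImprisoning ∧ L.CompactDiamonds

/-- Property (b). -/
def PropertyB : Prop := L.NonTotallyImprisoning ∧ L.CompactEmeralds

/-- Property (⋆): `J` is a closed order (closed in `X × X` and antisymmetric), and
`J⁺(K) ∩ J⁻(K)` is compact for every compact `K`. -/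
def PropertyStar : Prop :=
  (IsClosed {p : X × X | L.caus p.1 p.2} ∧ L.Causality) ∧
    ∀ K : Set X, IsCompact K → IsCompact (L.causalFuture K ∩ L.causalPast K)

end LorentzianPreLengthSpace

open Set Filter

/-! The hub is causality with compact diamonds. A timelike curve through `x` gives points `p n ≪ x ≪
q n` converging to `x`, and since `≪` is open, the diamonds they span are neighborhoods of `x`.
Compactness of diamonds then makes `J` closed, so an emerald is a closed subset of a finite union of
diamonds, hence compact.

Under causality these diamonds also shrink to `x`. They are causally convex, so a causal curve meets
each in one parameter interval; covering a compact set by finitely many of them turns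
ρ-compatibility into (β).

Conversely, (β) forces causality, because `x ≤ y ≤ x` with `x ≠ y` would allow a causal curve of
infinite length in a compact set. From (⋆), a diamond is closed in the emerald of `{p, q}`. -/

/-! ### Variation over a finite cover by intervals -/

/-- If the interval `[a, b]` is covered by finitely many closed order-connected sets, the variation
on `[a, b]` is at most the sum of bounds for the variations on these sets. -/
theorem eVariationOn_Icc_le_sum_of_isClosed_ordConnected {E ι : Type*} [PseudoEMetricSpace E]
    (f : ℝ → E) (T : ι → Set ℝ) (C : ι → ℝ≥0∞) (s : Finset ι) (a b : ℝ)
    (hclosed : ∀ i ∈ s, IsClosed (T i)) (hconn : ∀ i ∈ s, (T i).OrdConnected)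
    (hC : ∀ i ∈ s, eVariationOn f (T i) ≤ C i) (hcover : Icc a b ⊆ ⋃ i ∈ s, T i) :
    eVariationOn f (Icc a b) ≤ ∑ i ∈ s, C i := by
  classical
  induction s using Finset.strongInduction generalizing a with
  | H s ih =>
    rcases lt_or_ge b a with hab | hab
    · simp [Icc_eq_empty_of_lt hab]
    obtain ⟨j, hj, haj⟩ : ∃ j ∈ s, a ∈ T j := by
      simpa using hcover (left_mem_Icc.2 hab)
    have hcompact : IsCompact (Icc a b ∩ T j) := isCompact_Icc.inter_right (hclosed j hj)
    -- `c` is the last parameter spent in `T j`: the set `T j` pays for `[a, c]`, and the other sets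
    -- must cover what follows.
    obtain ⟨c, ⟨hcI, hcT⟩, hcmax⟩ :=
      hcompact.exists_isGreatest ⟨a, left_mem_Icc.2 hab, haj⟩
    have hleft : eVariationOn f (Icc a c) ≤ C j :=
      (eVariationOn.mono f ((hconn j hj).out haj hcT)).trans (hC j hj)
    have hclosedUnion : IsClosed (⋃ i ∈ s.erase j, T i) :=
      isClosed_biUnion_finset fun i hi => hclosed i (Finset.mem_of_mem_erase hi)
    have hcoverIoc : Ioc c b ⊆ ⋃ i ∈ s.erase j, T i := by
      intro r hr
      have hrI : r ∈ Icc a b := ⟨hcI.1.trans hr.1.le, hr.2⟩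
      obtain ⟨i, hi, hri⟩ : ∃ i ∈ s, r ∈ T i := by simpa using hcover hrI
      refine mem_biUnion (Finset.mem_coe.2 (Finset.mem_erase.2 ⟨?_, hi⟩)) hri
      rintro rfl
      exact hr.1.not_ge (hcmax ⟨hrI, hri⟩)
    have hsum : C j + ∑ i ∈ s.erase j, C i = ∑ i ∈ s, C i := Finset.add_sum_erase s C hj
    rcases hcI.2.eq_or_lt with hcb | hcb
    · subst hcb
      exact hleft.trans (hsum ▸ le_self_add)
    -- Closedness of the remaining sets recovers the endpoint `c`, so the induction applies to `[c,
    -- b]`.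
    · have hcoverIcc : Icc c b ⊆ ⋃ i ∈ s.erase j, T i := by
        rw [← closure_Ioc hcb.ne]
        exact closure_minimal hcoverIoc hclosedUnion
      have hright := ih (s.erase j) (Finset.erase_ssubset hj) c
        (fun i hi => hclosed i (Finset.mem_of_mem_erase hi))
        (fun i hi => hconn i (Finset.mem_of_mem_erase hi))
        (fun i hi => hC i (Finset.mem_of_mem_erase hi)) hcoverIcc
      have hsplit := eVariationOn.Icc_add_Icc f (s := univ) hcI.1 hcI.2 (mem_univ c)
      simp only [univ_inter] at hsplit
      rw [← hsplit, ← hsum]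
      exact add_le_add hleft hright

namespace LorentzianPreLengthSpace

variable {X : Type*} [MetricSpace X] {L : LorentzianPreLengthSpace X}

/-! ### Openness of `≪` and approximation by timelike curves -/

theorem isOpen_setOf_chron : IsOpen {p : X × X | L.chron p.1 p.2} := by
  have h := L.dist_lsc.isOpen_preimage 0
  convert h using 1
  ext p
  exact (L.dist_pos_iff p.1 p.2).symm

theorem isOpen_setOf_chron_left (p : X) : IsOpen {x | L.chron p x} :=
  (isOpen_setOf_chron (L := L)).preimage (Continuous.prodMk_right p)

theorem isOpen_setOf_chron_right (q : X) : IsOpen {x | L.chron x q} :=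
  (isOpen_setOf_chron (L := L)).preimage (Continuous.prodMk_left q)

theorem mem_diamond {p q x : X} :
    x ∈ L.causalFuture {p} ∩ L.causalPast {q} ↔ L.caus p x ∧ L.caus x q := by
  simp [causalFuture, causalPast]

theorem TimelikeCurveThroughEachPoint.exists_chron_seq (h : L.TimelikeCurveThroughEachPoint)
    (x : X) : ∃ p q : ℕ → X, (∀ n, L.chron (p n) x) ∧ (∀ n, L.chron x (q n)) ∧
      (∀ m n, m ≤ n → L.caus (p m) (p n)) ∧ (∀ m n, m ≤ n → L.caus (q n) (q m)) ∧
      Tendsto p atTop (𝓝 x) ∧ Tendsto q atTop (𝓝 x) := by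
  obtain ⟨γ, S, hγ, t, ht, rfl⟩ := h x
  obtain ⟨δ, hδ, hball⟩ := Metric.mem_nhds_iff.1 (mem_interior_iff_mem_nhds.1 ht)
  have hS : ∀ r, |r - t| < δ → r ∈ S := fun r hr => hball (by simpa [Real.dist_eq] using hr)
  have hcont : ContinuousAt γ t :=
    hγ.locallyLipschitz.continuousOn.continuousAt (mem_interior_iff_mem_nhds.1 ht)
  let e : ℕ → ℝ := fun n => δ / 2 * (1 / ((n : ℝ) + 1))
  have hepos : ∀ n, 0 < e n := fun n => by positivity
  have hanti : ∀ m n, m ≤ n → e n ≤ e m := fun m n hmn => by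
    have : (m : ℝ) ≤ n := by exact_mod_cast hmn
    simp only [e]
    gcongr
  have hele : ∀ n, e n < δ := fun n => by
    have h0 : e 0 = δ / 2 := by simp [e]
    linarith [hanti 0 n n.zero_le]
  have hetend : Tendsto e atTop (𝓝 0) := by
    simpa [e] using tendsto_one_div_add_atTop_nhds_zero_nat.const_mul (δ / 2)
  have hmem : ∀ n, t - e n ∈ S ∧ t + e n ∈ S := fun n =>
    ⟨hS _ (by simpa [abs_of_pos (hepos n)] using hele n),
      hS _ (by simpa [abs_of_pos (hepos n)] using hele n)⟩
  have hcaus : ∀ r ∈ S, ∀ s ∈ S, r ≤ s → L.caus (γ r) (γ s) := by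
    intro r hr s hs hrs
    rcases hrs.eq_or_lt with rfl | hlt
    · exact L.caus_refl _
    · exact L.caus_of_chron _ _ (hγ.timelike r hr s hs hlt)
  have htS : t ∈ S := interior_subset ht
  refine ⟨fun n => γ (t - e n), fun n => γ (t + e n), fun n => ?_, fun n => ?_,
    fun m n hmn => ?_, fun m n hmn => ?_, ?_, ?_⟩
  · exact hγ.timelike _ (hmem n).1 _ htS (by linarith [hepos n])
  · exact hγ.timelike _ htS _ (hmem n).2 (by linarith [hepos n])
  · exact hcaus _ (hmem m).1 _ (hmem n).1 (by linarith [hanti m n hmn])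
  · exact hcaus _ (hmem n).2 _ (hmem m).2 (by linarith [hanti m n hmn])
  · exact hcont.tendsto.comp (by simpa using hetend.const_sub t)
  · exact hcont.tendsto.comp (by simpa using hetend.const_add t)

/-! ### Closedness of `J` and compact emeralds -/

/-- Two successive limits in closed diamonds. For fixed `k` the second components eventually lie
between `p k` and `q 0`, so `p k ≤ y`; then `p k → x` inside the diamond from `p 0` to `y`. -/
theorem CompactDiamonds.isClosed_caus (hD : L.CompactDiamonds)
    (hthrough : L.TimelikeCurveThroughEachPoint) : IsClosed {p : X × X | L.caus p.1 p.2} := by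
  refine isSeqClosed_iff_isClosed.1 fun z w hz hw => ?_
  obtain ⟨x, y⟩ := w
  have hx : Tendsto (fun n => (z n).1) atTop (𝓝 x) := (continuous_fst.tendsto _).comp hw
  have hy : Tendsto (fun n => (z n).2) atTop (𝓝 y) := (continuous_snd.tendsto _).comp hw
  obtain ⟨p, -, hpx, -, hp, -, hptend, -⟩ := hthrough.exists_chron_seq x
  obtain ⟨-, q, -, hyq, -, -, -, -⟩ := hthrough.exists_chron_seq y
  have hpy : ∀ k, L.caus (p k) y := fun k => by
    refine (mem_diamond.1 ((hD (p k) (q 0)).isClosed.mem_of_tendsto hy ?_)).1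
    filter_upwards [hx.eventually ((isOpen_setOf_chron_left (p k)).mem_nhds (hpx k)),
      hy.eventually ((isOpen_setOf_chron_right (q 0)).mem_nhds (hyq 0))] with n hn hn'
    exact mem_diamond.2 ⟨L.caus_trans _ _ _ (L.caus_of_chron _ _ hn) (hz n),
      L.caus_of_chron _ _ hn'⟩
  exact (mem_diamond.1 ((hD (p 0) y).isClosed.mem_of_tendsto hptend
    (Eventually.of_forall fun n => mem_diamond.2 ⟨hp 0 n n.zero_le, hpy n⟩))).2

theorem isClosed_causalFuture (hJ : IsClosed {p : X × X | L.caus p.1 p.2}) {K : Set X}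
    (hK : IsCompact K) : IsClosed (L.causalFuture K) := by
  refine isSeqClosed_iff_isClosed.1 fun y w hy hw => ?_
  choose x hxK hxy using hy
  obtain ⟨a, haK, φ, hφ, ha⟩ := hK.tendsto_subseq hxK
  exact ⟨a, haK, hJ.mem_of_tendsto (ha.prodMk_nhds (hw.comp hφ.tendsto_atTop))
    (Eventually.of_forall fun n => hxy (φ n))⟩

theorem isClosed_causalPast (hJ : IsClosed {p : X × X | L.caus p.1 p.2}) {K : Set X}
    (hK : IsCompact K) : IsClosed (L.causalPast K) := by
  refine isSeqClosed_iff_isClosed.1 fun y w hy hw => ?_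
  choose x hxK hxy using hy
  obtain ⟨a, haK, φ, hφ, ha⟩ := hK.tendsto_subseq hxK
  exact ⟨a, haK, hJ.mem_of_tendsto ((hw.comp hφ.tendsto_atTop).prodMk_nhds ha)
    (Eventually.of_forall fun n => hxy (φ n))⟩

/-- Finitely many chronological futures cover `K₁` and finitely many pasts cover `K₂`; the diamonds
of their vertices contain the emerald. -/
theorem CompactDiamonds.compactEmeralds (hD : L.CompactDiamonds)
    (hthrough : L.TimelikeCurveThroughEachPoint) : L.CompactEmeralds := by
  intro K₁ K₂ hK₁ hK₂
  have hJ := hD.isClosed_caus hthrough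
  choose p q hpx hxq _ _ _ _ using hthrough.exists_chron_seq
  obtain ⟨s, -, hs⟩ := hK₁.elim_nhds_subcover (fun x => {y | L.chron (p x 0) y})
    fun x _ => (isOpen_setOf_chron_left _).mem_nhds (hpx x 0)
  obtain ⟨t, -, ht⟩ := hK₂.elim_nhds_subcover (fun x => {y | L.chron y (q x 0)})
    fun x _ => (isOpen_setOf_chron_right _).mem_nhds (hxq x 0)
  refine IsCompact.of_isClosed_subset
    (s.isCompact_biUnion fun x _ => t.isCompact_biUnion fun y _ => hD (p x 0) (q y 0))
    ((isClosed_causalFuture hJ hK₁).inter (isClosed_causalPast hJ hK₂)) ?_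
  rintro z ⟨⟨x, hx, hxz⟩, y, hy, hzy⟩
  obtain ⟨i, hi, hix⟩ := mem_iUnion₂.1 (hs hx)
  obtain ⟨j, hj, hjy⟩ := mem_iUnion₂.1 (ht hy)
  exact mem_iUnion₂.2 ⟨i, hi, mem_iUnion₂.2 ⟨j, hj, mem_diamond.2
    ⟨L.caus_trans _ _ _ (L.caus_of_chron _ _ hix) hxz,
      L.caus_trans _ _ _ hzy (L.caus_of_chron _ _ hjy)⟩⟩⟩

/-! ### Small diamonds and property (β) -/

/-- Every neighborhood of a point contains a causal diamond that is a neighborhood of it. -/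
theorem CompactDiamonds.exists_diamond_subset (hD : L.CompactDiamonds) (hcausal : L.Causality)
    (hthrough : L.TimelikeCurveThroughEachPoint) {x : X} {U : Set X} (hU : U ∈ 𝓝 x) :
    ∃ p q, L.causalFuture {p} ∩ L.causalPast {q} ∈ 𝓝 x ∧
      L.causalFuture {p} ∩ L.causalPast {q} ⊆ U := by
  have hJ := hD.isClosed_caus hthrough
  obtain ⟨p, q, hpx, hxq, hp, hq, hptend, hqtend⟩ := hthrough.exists_chron_seq x
  -- The compact diamonds are nested. A point `z` common to all of them satisfies `x ≤ z ≤ x` since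
  -- `J` is closed, so their intersection is `{x}`.
  obtain ⟨n, hn⟩ := exists_subset_nhds_of_isCompact
    (V := fun n => L.causalFuture {p n} ∩ L.causalPast {q n}) (U := U)
    (directed_of_isDirected_le fun m n hmn z hz => by
      rw [mem_diamond] at hz ⊢
      exact ⟨L.caus_trans _ _ _ (hp m n hmn) hz.1, L.caus_trans _ _ _ hz.2 (hq m n hmn)⟩)
    (fun n => hD (p n) (q n)) fun z hz => by
      have hz' : ∀ n, L.caus (p n) z ∧ L.caus z (q n) :=
        fun n => mem_diamond.1 (mem_iInter.1 hz n)
      have hxz : L.caus x z := hJ.mem_of_tendsto (hptend.prodMk_nhds tendsto_const_nhds)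
        (Eventually.of_forall fun n => (hz' n).1)
      have hzx : L.caus z x := hJ.mem_of_tendsto (tendsto_const_nhds.prodMk_nhds hqtend)
        (Eventually.of_forall fun n => (hz' n).2)
      rwa [← hcausal x z hxz hzx]
  refine ⟨p n, q n, ?_, hn⟩
  filter_upwards [(isOpen_setOf_chron_left (p n)).mem_nhds (hpx n),
    (isOpen_setOf_chron_right (q n)).mem_nhds (hxq n)] with z hz hz'
  exact mem_diamond.2 ⟨L.caus_of_chron _ _ hz, L.caus_of_chron _ _ hz'⟩

theorem IsCausalCurve.caus_of_le {γ : ℝ → X} {S : Set ℝ} (hγ : L.IsCausalCurve γ S) {r s : ℝ}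
    (hr : r ∈ S) (hs : s ∈ S) (hrs : r ≤ s) : L.caus (γ r) (γ s) := by
  rcases hrs.eq_or_lt with rfl | hlt
  · exact L.caus_refl _
  · exact hγ.causal r hr s hs hlt

theorem CompactDiamonds.nonTotallyImprisoning (hD : L.CompactDiamonds) (hcausal : L.Causality)
    (hrho : L.RhoCompatible) (hthrough : L.TimelikeCurveThroughEachPoint) :
    L.NonTotallyImprisoning := by
  intro K hK
  choose U hU C hC using hrho
  choose p q hnhds hsub using fun x => hD.exists_diamond_subset hcausal hthrough (hU x)
  obtain ⟨s, -, hs⟩ := hK.elim_nhds_subcover _ fun x _ => hnhds x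
  refine ⟨∑ x ∈ s, C x, fun γ S hγ hmaps => ?_⟩
  -- `S` need not be compact, so the bound is proved uniformly on its compact subintervals.
  rw [eVariationOn.eq_biSup_inter_Icc]
  refine iSup₂_le fun ⟨a, b⟩ ⟨ha, hb, hab⟩ => ?_
  have hIcc : Icc a b ⊆ S := hγ.interval.out ha hb
  rw [inter_eq_right.2 hIcc, ENNReal.ofNNReal_finsetSum]
  -- Causal convexity of diamonds: a causal curve cannot leave one and return.
  have hconn : ∀ x, (Icc a b ∩ γ ⁻¹' (L.causalFuture {p x} ∩ L.causalPast {q x})).OrdConnected := by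
    refine fun x => ⟨fun r hr t ht u hu => ?_⟩
    have huI : u ∈ Icc a b := ⟨hr.1.1.trans hu.1, hu.2.trans ht.1.2⟩
    exact ⟨huI, mem_diamond.2
      ⟨L.caus_trans _ _ _ (mem_diamond.1 hr.2).1 (hγ.caus_of_le (hIcc hr.1) (hIcc huI) hu.1),
        L.caus_trans _ _ _ (hγ.caus_of_le (hIcc huI) (hIcc ht.1) hu.2) (mem_diamond.1 ht.2).2⟩⟩
  refine eVariationOn_Icc_le_sum_of_isClosed_ordConnected γ
    (fun x => Icc a b ∩ γ ⁻¹' (L.causalFuture {p x} ∩ L.causalPast {q x})) (fun x => C x) s a b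
    (fun x _ => ?_) (fun x _ => hconn x) (fun x _ => ?_) fun r hr => ?_
  · exact (hγ.locallyLipschitz.continuousOn.mono hIcc).preimage_isClosed_of_isClosed isClosed_Icc
      (hD _ _).isClosed
  -- A constant piece is not a causal curve by definition, but has zero variation.
  · by_cases hconst :
        (γ '' (Icc a b ∩ γ ⁻¹' (L.causalFuture {p x} ∩ L.causalPast {q x}))).Subsingleton
    · exact (eVariationOn.constant_on hconst).trans_le zero_le
    · have hnon := not_subsingleton_iff.1 hconst
      obtain ⟨_, ⟨r, hr, rfl⟩, _, ⟨t, ht, rfl⟩, hrt⟩ := hnon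
      exact hC x γ _
        { interval := hconn x
          nonconstant := ⟨r, hr, t, ht, hrt⟩
          locallyLipschitz := hγ.locallyLipschitz.mono (inter_subset_left.trans hIcc)
          causal := fun r hr t ht => hγ.causal r (hIcc hr.1) t (hIcc ht.1) }
        fun r hr => hsub x hr.2
  · obtain ⟨x, hx, hrx⟩ := mem_iUnion₂.1 (hs (hmaps (hIcc hr)))
    exact mem_iUnion₂.2 ⟨x, hx, hr, hrx⟩

/-! ### Causality from (β), and diamonds from (⋆) -/

/-- If `x ≤ y ≤ x` with `x ≠ y`, a curve oscillating between `x` and `y` is causal and has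
infinite length. -/
theorem NonTotallyImprisoning.causality (hβ : L.NonTotallyImprisoning)
    (hpath : L.CausallyPathConnected) : L.Causality := by
  intro x y hxy hyx
  by_contra hne
  obtain ⟨a, b, γ, hab, hγ, rfl, rfl⟩ := hpath.2 x y hxy hne
  have haI : a ∈ Icc a b := left_mem_Icc.2 hab
  have hbI : b ∈ Icc a b := right_mem_Icc.2 hab
  obtain ⟨M, hM⟩ := hγ.locallyLipschitz.exists_lipschitzOnWith_of_compact isCompact_Icc
  obtain ⟨C, hC⟩ := hβ (γ '' Icc a b) (isCompact_Icc.image_of_continuousOn hM.continuousOn)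
  -- A Lipschitz sweep of `[a, b]` back and forth, equal to `a` at even and `b` at odd multiples of
  -- `π`.
  let g : ℝ → ℝ := fun t => a + (b - a) / 2 * (1 - Real.cos t)
  have hg : ∀ t, g t ∈ Icc a b := fun t => by
    have h1 := Real.cos_le_one t
    have h2 := Real.neg_one_le_cos t
    constructor <;> simp only [g] <;> nlinarith
  have hgLip : LipschitzWith ((b - a) / 2).toNNReal g := by
    refine LipschitzWith.of_dist_le_mul fun s t => ?_
    have hcos := Real.lipschitzWith_cos.dist_le_mul s t
    have hnn : 0 ≤ (b - a) / 2 := by linarith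
    have heq : g s - g t = -((b - a) / 2 * (Real.cos s - Real.cos t)) := by simp only [g]; ring
    rw [Real.coe_toNNReal _ hnn, Real.dist_eq, heq, abs_neg, abs_mul, abs_of_nonneg hnn]
    simp only [Real.dist_eq, NNReal.coe_one, one_mul] at hcos ⊢
    gcongr
  have hcomp : LipschitzWith (M * ((b - a) / 2).toNNReal) (γ ∘ g) :=
    lipschitzOnWith_univ.1 (hM.comp hgLip.lipschitzOnWith fun t _ => hg t)
  -- Going around the loop, `γ r ≤ y ≤ x ≤ γ s`, so running backwards along `γ` is causal too.
  have hcaus : ∀ r ∈ Icc a b, ∀ s ∈ Icc a b, L.caus (γ r) (γ s) := fun r hr s hs =>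
    L.caus_trans _ _ _ (hγ.caus_of_le hr hbI hr.2)
      (L.caus_trans _ _ _ hyx (hγ.caus_of_le haI hs hs.1))
  have hval : ∀ n : ℕ, edist ((γ ∘ g) ((n + 1 : ℕ) * Real.pi)) ((γ ∘ g) (n * Real.pi)) =
      edist (γ a) (γ b) := by
    intro n
    rcases Nat.even_or_odd n with hn | hn
    · have h1 : g (n * Real.pi) = a := by simp [g, Real.cos_nat_mul_pi, hn.neg_one_pow]
      have h2 : g ((n + 1 : ℕ) * Real.pi) = b := by
        simp only [g, Real.cos_nat_mul_pi, hn.add_one.neg_one_pow]; ring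
      rw [Function.comp_apply, Function.comp_apply, h1, h2, edist_comm]
    · have h1 : g (n * Real.pi) = b := by
        simp only [g, Real.cos_nat_mul_pi, hn.neg_one_pow]; ring
      have h2 : g ((n + 1 : ℕ) * Real.pi) = a := by
        simp only [g, Real.cos_nat_mul_pi, hn.add_one.neg_one_pow]; ring
      rw [Function.comp_apply, Function.comp_apply, h1, h2]
  have hcurve : L.IsCausalCurve (γ ∘ g) univ :=
    { interval := ordConnected_univ
      nonconstant := ⟨(0 + 1 : ℕ) * Real.pi, mem_univ _, (0 : ℕ) * Real.pi, mem_univ _, fun h => by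
        have h0 := hval 0
        rw [h, edist_self] at h0
        exact hne (edist_eq_zero.1 h0.symm)⟩
      locallyLipschitz := locallyLipschitzOn_univ.2 hcomp.locallyLipschitz
      causal := fun s _ t _ _ => hcaus _ (hg s) _ (hg t) }
  have hbound := hC _ _ hcurve fun t _ => ⟨g t, hg t, rfl⟩
  have hmul : ∀ n : ℕ, (n : ℝ≥0∞) * edist (γ a) (γ b) ≤ C := fun n => by
    have h := eVariationOn.sum_le (f := γ ∘ g) (s := univ) (n := n)
      (u := fun k : ℕ => (k : ℝ) * Real.pi)
      (fun k l hkl => mul_le_mul_of_nonneg_right (Nat.cast_le.2 hkl) Real.pi_pos.le)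
      fun _ => mem_univ _
    rw [Finset.sum_congr rfl fun k _ => hval k] at h
    simpa using h.trans hbound
  obtain ⟨n, hn⟩ := ENNReal.exists_nat_mul_gt (mt edist_eq_zero.1 hne) (b := (C : ℝ≥0∞))
    ENNReal.coe_ne_top
  exact hn.not_ge (hmul n)

theorem PropertyStar.compactDiamonds (h : L.PropertyStar) : L.CompactDiamonds := by
  intro p q
  have hpq : IsCompact ({p, q} : Set X) := (finite_singleton q).insert p |>.isCompact
  refine (h.2 _ hpq).of_isClosed_subset ((isClosed_causalFuture h.1.1 isCompact_singleton).inter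
    (isClosed_causalPast h.1.1 isCompact_singleton)) fun z hz => ?_
  rw [mem_diamond] at hz
  exact ⟨⟨p, by simp, hz.1⟩, q, by simp, hz.2⟩

end LorentzianPreLengthSpace

theorem mainTheorem5 {X : Type*} [MetricSpace X] (L : LorentzianPreLengthSpace X)
    (hpath : L.CausallyPathConnected) (hrho : L.RhoCompatible)
    (hthrough : L.TimelikeCurveThroughEachPoint) :
    List.TFAE [L.PropertyA, L.PropertyB, L.PropertyStar,
      L.Causality ∧ L.CompactDiamonds] := by
  tfae_have 1 → 4 := fun h => ⟨h.1.causality hpath, h.2⟩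
  tfae_have 4 → 2 := fun h =>
    ⟨h.2.nonTotallyImprisoning h.1 hrho hthrough, h.2.compactEmeralds hthrough⟩
  tfae_have 2 → 1 := fun h => ⟨h.1, fun p q => h.2 _ _ isCompact_singleton isCompact_singleton⟩
  tfae_have 4 → 3 := fun h => ⟨⟨h.2.isClosed_caus hthrough, h.1⟩,
    fun K hK => h.2.compactEmeralds hthrough K K hK hK⟩
  tfae_have 3 → 4 := fun h => ⟨h.1.2, h.compactDiamonds⟩
  tfae_finish
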